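/- **Setting.** There are $n\ge 1$ users; user $i\in[n]$ holds an item $X_i\in\{e_1,\dots,e_d\}$ (one-hot vectors), and for a set of users $A$ the histogram is $\mu(X_A)=\sum_{i\in A}X_i$. An aggregation protocol consists of random variables $\theta_{[n]}=(\theta_1,\dots,\theta_n)$ (the users' randomness), possibly dependent on each other but jointly independent of $X_{[n]}$; encoders giving the messages $Y_i=g_i(X_i;\theta_i)$, with values in countable alphabets; second-round information $h(\theta_{[n]},\mathcal D)$ for each set $\mathcal D\subseteq[n]$ of users that drop out (trivial if $\mathcal D=\emptyset$); and a deterministic decoder $f$, which may depend on $\mathcal D$. For an integer $D\ge 0$ consider the following constraints, required for every joint distribution $P_{X_{[n]}}$ of the data: - (S1) for all $\mathcal D\subseteq[n]$: $I\big(Y_{[n]\setminus\mathcal D},h(\theta_{[n]},\mathcal D);X_{[n]\setminus\mathcal D}\,\big|\,\mu(X_{[n]\setminus\mathcal D})\big)=0$; - (S2) for all $\mathcal D\subseteq[n]$ with $|\mathcal D|>D$: $I\big(Y_{[n]\setminus\mathcal D},h(\theta_{[n]},\mathcal D);X_{[n]\setminus\mathcal D}\big)=0$; - (C1) for all $\mathcal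 D\subseteq[n]$ with $|\mathcal D|\le D$: $\Pr\{f(Y_{[n]\setminus\mathcal D},h(\theta_{[n]},\mathcal D))=\mu(X_{[n]\setminus\mathcal D})\}=1$. The communication cost of user $i$ is $\sup_{P_{X_{[n]}}}H(Y_i)$, where $H$ is the Shannon entropy in bits. **Theorem.** To compute the histogram securely (S1, S2) and correctly (C1), $\Theta(n\log d)$ bits per user are necessary, when $d$ is polynomially larger than $n$, and sufficient. Precisely: 1. (Necessity.) For every $\kappa\in(0,1)$ there is $c>0$, depending only on $\kappa$, such that for all integers $n\ge 1$, $d$, $D\ge 0$ with $n\le d^{1-\kappa}$, in every protocol that satisfies (S1), (S2) and (C1) every user has communication cost at least $c\,n\log_2 d$. 2. (Sufficiency.) There is an absolute constant $C>0$ such that for all integers $n\ge1$, $d\ge 1$, $D\ge 0$ there is a protocol that satisfies (S1), (S2) and (C1) in which every user has communication cost at most $C\,n\log_2 d$. -/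

import Mathlib

open MeasureTheory ProbabilityTheory InformationTheory
open scoped ENNReal

noncomputable section

/-- Shannon entropy in bits of a probability law on a countable alphabet; it may be infinite. -/
def shannonEntropy {α : Type*} [MeasurableSpace α] (P : Measure α) : ℝ≥0∞ :=
  ∑' a : α, ENNReal.ofReal (Real.negMulLog (P.real {a}) / Real.log 2)

/-- Mutual information `I(A; B)` under the probability measure `μ`: the divergence of the joint
law from the product of the marginal laws. (In nats; only its vanishing is used.) -/
def mutualInfo {Ω α β : Type*} [MeasurableSpace Ω] [MeasurableSpace α] [MeasurableSpace β]
    (μ : Measure Ω) (A : Ω → α) (B : Ω → β) : ℝ≥0∞ :=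
  klDiv (μ.map (fun ω => (A ω, B ω))) ((μ.map A).prod (μ.map B))

/-- Conditional mutual information `I(A; B | C)` for a random variable `C` with countably many
values: the average over the values `c` of the mutual information given `C = c`. -/
def condMutualInfo {Ω α β γ : Type*} [MeasurableSpace Ω] [MeasurableSpace α] [MeasurableSpace β]
    (μ : Measure Ω) (A : Ω → α) (B : Ω → β) (C : Ω → γ) : ℝ≥0∞ :=
  ∑' c : γ, μ (C ⁻¹' {c}) * mutualInfo (cond μ (C ⁻¹' {c})) A B

/-- The histogram of a finite family of items from `Fin d`: the sum of their one-hot vectors. -/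
def histogram {ι : Type*} [Fintype ι] {d : ℕ} (x : ι → Fin d) : Fin d → ℕ :=
  ∑ i, Pi.single (x i) 1

/-- A single-server aggregation protocol for `n` users, each holding an item from `Fin d`.
`rand` is the joint law of the users' randomness `θ = (θ₁, …, θₙ)`, whose components may be
dependent. User `i` sends `enc i xᵢ θᵢ`. If the set `S` of users drops out, the server gets the
messages of the other users and then the second-round information `aux S θ`, and it outputs
`dec S` of both. There is no second round if nobody drops out: `aux ∅` is constant. -/
structure AggProtocol (n d : ℕ) where
  Rand : Fin n → Type
  [randMeas : ∀ i, MeasurableSpace (Rand i)]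
  rand : Measure (∀ i, Rand i)
  [randProb : IsProbabilityMeasure rand]
  Msg : Fin n → Type
  [msgMeas : ∀ i, MeasurableSpace (Msg i)]
  [msgCountable : ∀ i, Countable (Msg i)]
  [msgSingleton : ∀ i, MeasurableSingletonClass (Msg i)]
  enc : ∀ i, Fin d → Rand i → Msg i
  measurable_enc : ∀ i x, Measurable (enc i x)
  Aux : Finset (Fin n) → Type
  [auxMeas : ∀ S, MeasurableSpace (Aux S)]
  aux : ∀ S, (∀ i, Rand i) → Aux S
  measurable_aux : ∀ S, Measurable (aux S)
  aux_empty : ∀ θ θ', aux ∅ θ = aux ∅ θ'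
  dec : ∀ S : Finset (Fin n), (∀ i : {i // i ∉ S}, Msg i) × Aux S → (Fin d → ℕ)
  measurable_dec : ∀ S, Measurable (dec S)

attribute [instance] AggProtocol.randMeas AggProtocol.randProb AggProtocol.msgMeas
  AggProtocol.msgCountable AggProtocol.msgSingleton AggProtocol.auxMeas

namespace AggProtocol

variable {n d : ℕ} (p : AggProtocol n d)

/-- Outcomes: the users' data together with the users' randomness. -/
abbrev Outcome : Type := (Fin n → Fin d) × (∀ i, p.Rand i)

/-- The law of all data and randomness if the data have joint law `P`: the randomness is
independent of the data. -/
def law (P : Measure (Fin n → Fin d)) : Measure p.Outcome := P.prod p.rand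

/-- The message `Yᵢ` of user `i`. -/
def msg (i : Fin n) (ω : p.Outcome) : p.Msg i := p.enc i (ω.1 i) (ω.2 i)

/-- What the server sees if the users in `S` drop out. -/
def view (S : Finset (Fin n)) (ω : p.Outcome) : (∀ i : {i // i ∉ S}, p.Msg i) × p.Aux S :=
  (fun i => p.msg i ω, p.aux S ω.2)

/-- The data of the users outside `S`. -/
def survData (S : Finset (Fin n)) (ω : p.Outcome) : {i // i ∉ S} → Fin d := fun i => ω.1 i

/-- The histogram of the data of the users outside `S`. -/
def survHist (S : Finset (Fin n)) (ω : p.Outcome) : Fin d → ℕ := histogram (p.survData S ω)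

/-- First security constraint: for every law of the data and every set `S` of dropouts, given
the histogram of the survivors, what the server sees carries no information on their data. -/
def SecureGivenSum : Prop :=
  ∀ P : Measure (Fin n → Fin d), IsProbabilityMeasure P → ∀ S : Finset (Fin n),
    condMutualInfo (p.law P) (p.view S) (p.survData S) (p.survHist S) = 0

/-- Second security constraint: for every law of the data, if more than `D` users drop out,
what the server sees carries no information on the data of the survivors. -/
def SecureBeyond (D : ℕ) : Prop :=
  ∀ P : Measure (Fin n → Fin d), IsProbabilityMeasure P → ∀ S : Finset (Fin n), D < S.card →
    mutualInfo (p.law P) (p.view S) (p.survData S) = 0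

/-- Correctness constraint: for every law of the data, if at most `D` users drop out, the server
recovers the histogram of the survivors with probability one. -/
def Correct (D : ℕ) : Prop :=
  ∀ P : Measure (Fin n → Fin d), IsProbabilityMeasure P → ∀ S : Finset (Fin n), S.card ≤ D →
    ∀ᵐ ω ∂(p.law P), p.dec S (p.view S ω) = p.survHist S ω

/-- Communication cost of user `i`: the worst-case entropy, in bits, of the message of user `i`
over all joint laws of the data. -/
def commCost (i : Fin n) : ℝ≥0∞ :=
  ⨆ (P : Measure (Fin n → Fin d)) (_ : IsProbabilityMeasure P),
    shannonEntropy ((p.law P).map (p.msg i))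

end AggProtocol

end

/-! Necessity uses uniform data and no dropouts. Security makes the law of all messages depend on
the data only through the histogram, so it survives permuting the data; the messages of the users
other than `i` do not involve `xᵢ`. Together these invariances make the other messages independent
of the data (`otherMsgs_law_eq`). Once `Yᵢ = y` is fixed, correctness makes the histogram a function
of the other messages, and guessing a histogram independently of the data succeeds with probability
at most `(n/d)^n`. Hence every value of `Yᵢ` has probability at most `(n/d)^n ≤ d^(-κn)`
(`measure_msg_preimage_le`), and `H(Yᵢ) ≥ κ n log₂ d`.

Sufficiency: encode items as elements `α - a` of the unit group of a field with `q^(n+1)` elements,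
where `α` has degree `n + 1` over the prime field. Products of at most `n` such elements determine
the factors (Bose–Chowla), so computing a histogram reduces to computing a product in a group of
size `d^O(n)`, which one-time pads with product `1` do securely (`padProtocol`). -/

/-! ### Vanishing information in terms of the laws given the data. -/

theorem mutualInfo_eq_zero_iff_indepFun {Ω α β : Type*} [MeasurableSpace Ω] [MeasurableSpace α]
    [MeasurableSpace β] {μ : Measure Ω} [IsProbabilityMeasure μ] {A : Ω → α} {B : Ω → β}
    (hA : Measurable A) (hB : Measurable B) : mutualInfo μ A B = 0 ↔ IndepFun A B μ := by
  have := Measure.isProbabilityMeasure_map (μ := μ) hA.aemeasurable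
  have := Measure.isProbabilityMeasure_map (μ := μ) hB.aemeasurable
  have := Measure.isProbabilityMeasure_map (μ := μ) (hA.prodMk hB).aemeasurable
  rw [mutualInfo, klDiv_eq_zero_iff,
    indepFun_iff_map_prod_eq_prod_map_map hA.aemeasurable hB.aemeasurable]

theorem cond_prod_fst_preimage {X Θ : Type*} [MeasurableSpace X] [MeasurableSpace Θ] (P : Measure X)
    (R : Measure Θ) [SigmaFinite P] [IsProbabilityMeasure R] (E : Set X) :
    (P.prod R)[|Prod.fst ⁻¹' E] = (P[|E]).prod R := by
  rw [ProbabilityTheory.cond, ProbabilityTheory.cond, ← Set.prod_univ, Measure.prod_prod, measure_univ,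
    mul_one, ← Measure.prod_restrict, Measure.restrict_univ, Measure.prod_smul_left]

section ProductSpace

variable {X Θ α β γ : Type*} [MeasurableSpace X]
  [MeasurableSpace Θ] [MeasurableSpace α] [MeasurableSpace β] {A : X × Θ → α} {g : X → β}
  (P : Measure X) (R : Measure Θ) [IsProbabilityMeasure R]

theorem prod_inter_fst_preimage (hA : Measurable A) (ν : Measure α)
    (h : ∀ᵐ x ∂P, R.map (fun θ => A (x, θ)) = ν) {s : Set α} (hs : MeasurableSet s)
    {E : Set X} (hE : MeasurableSet E) :
    (P.prod R) (A ⁻¹' s ∩ Prod.fst ⁻¹' E) = ν s * P E := by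
  rw [Measure.prod_apply ((hA hs).inter (measurable_fst hE))]
  have : ∀ᵐ x ∂P, R (Prod.mk x ⁻¹' (A ⁻¹' s ∩ Prod.fst ⁻¹' E))
      = E.indicator (fun _ => ν s) x := by
    filter_upwards [h] with x hx
    by_cases hxE : x ∈ E
    · rw [Set.indicator_of_mem hxE, ← hx,
        Measure.map_apply (f := fun θ => A (x, θ)) (hA.comp measurable_prodMk_left) hs]
      congr 1
      ext θ
      simp [hxE]
    · rw [Set.indicator_of_notMem hxE]
      convert! measure_empty (μ := R)
      ext θ
      simp [hxE]
  rw [lintegral_congr_ae this, lintegral_indicator_const hE]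

theorem mutualInfo_prod_eq_zero [IsProbabilityMeasure P] (hA : Measurable A) (ν : Measure α)
    (h : ∀ᵐ x ∂P, R.map (fun θ => A (x, θ)) = ν) (hg : Measurable g) :
    mutualInfo (P.prod R) A (fun ω => g ω.1) = 0 := by
  have hgm : Measurable (fun ω : X × Θ => g ω.1) := hg.comp measurable_fst
  rw [mutualInfo_eq_zero_iff_indepFun hA hgm, indepFun_iff_measure_inter_preimage_eq_mul]
  intro s t hs ht
  have h1 := prod_inter_fst_preimage P R hA ν h hs MeasurableSet.univ
  simp only [Set.preimage_univ, Set.inter_univ, measure_univ, mul_one] at h1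
  rw [show (fun ω : X × Θ => g ω.1) ⁻¹' t = Prod.fst ⁻¹' (g ⁻¹' t) from rfl,
    prod_inter_fst_preimage P R hA ν h hs (hg ht), h1]
  congr 1
  rw [← Set.prod_univ, Measure.prod_prod, measure_univ, mul_one]

theorem condMutualInfo_prod_eq_zero [IsProbabilityMeasure P] [Countable X]
    [MeasurableSingletonClass X] (hA : Measurable A) (hg : Measurable g) (c : X → γ)
    (h : ∀ x x', c x = c x' →
      R.map (fun θ => A (x, θ)) = R.map (fun θ => A (x', θ))) :
    condMutualInfo (P.prod R) A (fun ω => g ω.1) (fun ω => c ω.1) = 0 := by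
  rw [condMutualInfo, ENNReal.tsum_eq_zero]
  intro z
  have hE : MeasurableSet (c ⁻¹' {z}) := (c ⁻¹' {z}).to_countable.measurableSet
  rw [show (fun ω : X × Θ => c ω.1) ⁻¹' {z} = Prod.fst ⁻¹' (c ⁻¹' {z}) from rfl,
    cond_prod_fst_preimage, ← Set.prod_univ, Measure.prod_prod, measure_univ, mul_one]
  by_cases h0 : P (c ⁻¹' {z}) = 0
  · simp [h0]
  have := cond_isProbabilityMeasure h0
  obtain ⟨x₀, hx₀⟩ := nonempty_of_measure_ne_zero h0
  rw [mutualInfo_prod_eq_zero _ _ hA (R.map (fun θ => A (x₀, θ))) _ hg, mul_zero]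
  filter_upwards [ae_cond_mem hE] with x hx
  exact h _ _ (hx.trans hx₀.symm)

/-- Converse of `condMutualInfo_prod_eq_zero`. Full support of `P` is what yields equality of laws
at every point and not merely almost everywhere. -/
theorem map_eq_of_condMutualInfo_eq_zero [IsProbabilityMeasure P] [Countable X]
    [MeasurableSingletonClass X] (hP : ∀ x, P {x} ≠ 0) (hA : Measurable A)
    [MeasurableSingletonClass β] (hg : Measurable g) (hinj : Function.Injective g) (c : X → γ)
    (h : condMutualInfo (P.prod R) A (fun ω => g ω.1) (fun ω => c ω.1) = 0)
    {x x' : X} (hx : c x = c x') :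
    R.map (fun θ => A (x, θ)) = R.map (fun θ => A (x', θ)) := by
  rw [condMutualInfo, ENNReal.tsum_eq_zero] at h
  have hE : MeasurableSet (c ⁻¹' {c x}) := (c ⁻¹' {c x}).to_countable.measurableSet
  have h1 := h (c x)
  rw [show (fun ω : X × Θ => c ω.1) ⁻¹' {c x} = Prod.fst ⁻¹' (c ⁻¹' {c x}) from rfl,
    cond_prod_fst_preimage, ← Set.prod_univ, Measure.prod_prod, measure_univ, mul_one] at h1
  have h0 : P (c ⁻¹' {c x}) ≠ 0 := fun h0 =>
    hP x (measure_mono_null (Set.singleton_subset_iff.2 (show x ∈ c ⁻¹' {c x} from rfl)) h0)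
  have := cond_isProbabilityMeasure h0
  replace h1 := (mul_eq_zero.1 h1).resolve_left h0
  have hgm : Measurable (fun ω : X × Θ => g ω.1) := hg.comp measurable_fst
  rw [mutualInfo_eq_zero_iff_indepFun hA hgm,
    indepFun_iff_measure_inter_preimage_eq_mul] at h1
  -- Since `g` is injective, `{g y}` singles out the atom `y`; independence on it can be divided by
  -- its positive mass.
  have key : ∀ y, c y = c x → ∀ s, MeasurableSet s →
      R.map (fun θ => A (y, θ)) s = (P[|c ⁻¹' {c x}]).prod R (A ⁻¹' s) := by
    intro y hy s hs
    have h2 := h1 s {g y} hs (measurableSet_singleton _)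
    rw [show A ⁻¹' s ∩ (fun ω : X × Θ => g ω.1) ⁻¹' {g y}
        = {y} ×ˢ ((fun θ => A (y, θ)) ⁻¹' s) by
          ext ⟨z, θ⟩
          simp only [Set.mem_inter_iff, Set.mem_preimage, Set.mem_singleton_iff, Set.mem_prod,
            hinj.eq_iff]
          constructor
          · rintro ⟨h, rfl⟩; exact ⟨rfl, h⟩
          · rintro ⟨rfl, h⟩; exact ⟨h, rfl⟩,
      show (fun ω : X × Θ => g ω.1) ⁻¹' {g y} = {y} ×ˢ Set.univ by ext; simp [hinj.eq_iff],
      Measure.prod_prod, Measure.prod_prod, measure_univ, mul_one, mul_comm,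
      ← Measure.map_apply (f := fun θ => A (y, θ)) (hA.comp measurable_prodMk_left) hs] at h2
    have h3 : (P[|c ⁻¹' {c x}]) {y} ≠ 0 := by
      rw [cond_apply hE, Set.inter_eq_self_of_subset_right (by simpa using hy)]
      exact mul_ne_zero (ENNReal.inv_ne_zero.2 (measure_ne_top _ _)) (hP y)
    exact (ENNReal.mul_left_inj h3 (measure_ne_top _ _)).1 h2
  ext s hs
  rw [key x rfl s hs, key x' hx.symm s hs]

end ProductSpace

/-! ### Histograms, and a group in which products determine them. -/

theorem histogram_apply {ι : Type*} [Fintype ι] {d : ℕ} (x : ι → Fin d) (a : Fin d) :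
    histogram x a = (Finset.univ.filter (fun i => x i = a)).card := by
  rw [histogram, Finset.sum_apply, Finset.card_filter]
  simp [Pi.single_apply, eq_comm]

theorem histogram_comp_equiv {ι κ : Type*} [Fintype ι] [Fintype κ] {d : ℕ} (x : κ → Fin d)
    (e : ι ≃ κ) : histogram (x ∘ e) = histogram x :=
  Equiv.sum_comp e (fun i => (Pi.single (x i) 1 : Fin d → ℕ))

theorem histogram_apply_pos_iff {ι : Type*} [Fintype ι] {d : ℕ} (x : ι → Fin d) (a : Fin d) :
    0 < histogram x a ↔ a ∈ Finset.univ.image x := by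
  simp [histogram_apply, Finset.card_pos, Finset.Nonempty]

/-- The items of a family with a given histogram are among the items of any other one. -/
theorem card_histogram_eq_le (n d : ℕ) (h : Fin d → ℕ) :
    (Finset.univ.filter (fun x : Fin n → Fin d => histogram x = h)).card ≤ n ^ n := by
  rcases (Finset.univ.filter (fun x : Fin n → Fin d => histogram x = h)).eq_empty_or_nonempty
    with h0 | ⟨x₀, hx₀⟩
  · simp [h0]
  have hsub : Finset.univ.filter (fun x : Fin n → Fin d => histogram x = h)
      ⊆ Fintype.piFinset fun _ => Finset.univ.image x₀ := by
    intro x hx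
    rw [Fintype.mem_piFinset]
    intro i
    rw [← histogram_apply_pos_iff, (Finset.mem_filter.1 hx₀).2, ← (Finset.mem_filter.1 hx).2,
      histogram_apply_pos_iff]
    exact Finset.mem_image_of_mem _ (Finset.mem_univ _)
  refine (Finset.card_le_card hsub).trans ?_
  rw [Fintype.card_piFinset_const]
  exact Nat.pow_le_pow_left (Finset.card_image_le.trans (by simp)) _

theorem count_map_univ_eq_histogram {ι : Type*} [Fintype ι] {d : ℕ} (x : ι → Fin d) (a : Fin d) :
    (Finset.univ.val.map x).count a = histogram x a := by
  rw [histogram_apply, Multiset.count_map]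
  simp [Finset.card, eq_comm]

theorem map_univ_eq_iff_histogram_eq {ι : Type*} [Fintype ι] {d : ℕ} (x x' : ι → Fin d) :
    Finset.univ.val.map x = Finset.univ.val.map x' ↔ histogram x = histogram x' := by
  simp only [Multiset.ext, count_map_univ_eq_histogram, funext_iff]

theorem prod_comp_eq_of_histogram_eq {ι M : Type*} [Fintype ι] [CommMonoid M] {d : ℕ}
    {x x' : ι → Fin d} (h : histogram x = histogram x') (φ : Fin d → M) :
    ∏ i, φ (x i) = ∏ i, φ (x' i) := by
  have := congrArg (fun s => (s.map φ).prod) ((map_univ_eq_iff_histogram_eq x x').2 h)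
  simpa [Multiset.map_map] using this

open Polynomial in
/-- An element of degree larger than `n` gives a multiplicative `B_n` sequence. -/
theorem histogram_eq_of_prod_sub_eq {F K ι : Type*} [Field F] [Field K] [Algebra F K] [Fintype ι]
    {d : ℕ} {α : K} {e : Fin d → F} (he : Function.Injective e)
    (hdeg : Fintype.card ι < (minpoly F α).natDegree) {x x' : ι → Fin d}
    (h : ∏ i, (α - algebraMap F K (e (x i))) = ∏ i, (α - algebraMap F K (e (x' i)))) :
    histogram x = histogram x' := by
  have hdegp : ∀ y : ι → Fin d, (∏ i, (X - C (e (y i)))).natDegree = Fintype.card ι := fun y => by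
    simp
  have hpoly : ∏ i, (X - C (e (x i))) = ∏ i, (X - C (e (x' i))) := by
    rw [← sub_eq_zero]
    -- A nonzero difference would have `α` as a root and degree below that of its minimal
    -- polynomial.
    by_contra hne
    have hroot : aeval α (∏ i, (X - C (e (x i))) - ∏ i, (X - C (e (x' i)))) = 0 := by
      simpa [sub_eq_zero, map_prod] using h
    have h1 := minpoly.degree_le_of_ne_zero F α hne hroot
    have h2 := natDegree_le_natDegree h1
    have h3 := natDegree_sub_le (∏ i, (X - C (e (x i)))) (∏ i, (X - C (e (x' i))))
    rw [hdegp, hdegp, max_self] at h3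
    omega
  have hmap : ∀ y : ι → Fin d, Finset.univ.val.map (fun i => X - C (e (y i)))
      = (Finset.univ.val.map (fun i => e (y i))).map (fun a => X - C a) := fun y => by
    simp [Multiset.map_map]
  have hroots := congrArg roots hpoly
  rw [Finset.prod_eq_multiset_prod, Finset.prod_eq_multiset_prod,
    hmap x, hmap x',
    roots_multiset_prod_X_sub_C, roots_multiset_prod_X_sub_C] at hroots
  rw [← map_univ_eq_iff_histogram_eq]
  apply Multiset.map_injective he
  simpa [Multiset.map_map] using hroots

/-- There is a finite abelian group of size `d ^ O(n)` in which `Fin d` embeds in such a way that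
the products of at most `n` factors determine their factors. -/
theorem exists_commGroup_histogram_eq_of_prod_eq (n d : ℕ) (hn : 1 ≤ n) (hd : 1 ≤ d) :
    ∃ (G : Type) (_ : CommGroup G) (_ : Finite G) (φ : Fin d → G), Nat.card G ≤ d ^ (4 * n) ∧
      ∀ S : Finset (Fin n), ∀ x x' : {i // i ∉ S} → Fin d,
        ∏ i, φ (x i) = ∏ i, φ (x' i) → histogram x = histogram x' := by
  -- For `d = 1` the size bound is `1`, which forces the trivial group.
  rcases hd.eq_or_lt with rfl | hd
  · refine ⟨Unit, inferInstance, inferInstance, fun _ => 1, by simp, fun S x x' _ => ?_⟩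
    rw [Subsingleton.elim x x']
  -- `q > d` keeps the items distinct modulo `q`; `q ≤ 2d ≤ d²` and `n + 1 ≤ 2n` give the size
  -- bound.
  obtain ⟨q, hq, hdq, hq2⟩ := Nat.exists_prime_lt_and_le_two_mul d (by omega)
  have := Fact.mk hq
  obtain ⟨α, hα⟩ := Field.exists_primitive_element_of_finite_top (ZMod q) (GaloisField q (n + 1))
  rw [Field.primitive_element_iff_minpoly_natDegree_eq, GaloisField.finrank q n.succ_ne_zero] at hα
  have hne : ∀ a : ZMod q, α - algebraMap _ _ a ≠ 0 := by
    intro a ha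
    rw [sub_eq_zero.1 ha, minpoly.eq_X_sub_C, Polynomial.natDegree_X_sub_C] at hα
    omega
  have he : Function.Injective (fun a : Fin d => ((a : ℕ) : ZMod q)) := by
    intro a b hab
    have := (ZMod.natCast_eq_natCast_iff' _ _ _).1 hab
    rw [Nat.mod_eq_of_lt (a.2.trans hdq), Nat.mod_eq_of_lt (b.2.trans hdq)] at this
    exact Fin.ext this
  refine ⟨(GaloisField q (n + 1))ˣ, inferInstance, inferInstance,
    fun a => Units.mk0 _ (hne (a : ℕ)), ?_, fun S x x' h => ?_⟩
  · calc Nat.card (GaloisField q (n + 1))ˣ ≤ Nat.card (GaloisField q (n + 1)) :=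
          Nat.card_le_card_of_injective _ Units.val_injective
      _ = q ^ (n + 1) := GaloisField.card q _ n.succ_ne_zero
      _ ≤ (d ^ 2) ^ (2 * n) := (Nat.pow_le_pow_left (hq2.trans (by nlinarith)) _).trans
          (Nat.pow_le_pow_right (by positivity) (by omega))
      _ = d ^ (4 * n) := by rw [← pow_mul]; congr 1; ring
  · refine histogram_eq_of_prod_sub_eq (α := α) he ?_ ?_
    · rw [hα]
      exact Nat.lt_succ_of_le ((Fintype.card_subtype_le _).trans (by simp))
    · simpa using congrArg Units.val h

/-! ### Security from equality of view laws. -/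

namespace AggProtocol

variable {n d : ℕ} (p : AggProtocol n d)

theorem measurable_msg (i : Fin n) : Measurable (p.msg i) := by
  refine measurable_from_prod_countable_right fun x => ?_
  exact (p.measurable_enc i (x i)).comp (measurable_pi_apply i)

theorem measurable_view (S : Finset (Fin n)) : Measurable (p.view S) :=
  Measurable.prodMk (f := fun ω (i : {i // i ∉ S}) => p.msg i ω)
    (measurable_pi_lambda _ fun i => p.measurable_msg i)
    ((p.measurable_aux S).comp measurable_snd)

/-- The law of what the server sees for given data `x`. -/
noncomputable def viewLaw (S : Finset (Fin n)) (x : Fin n → Fin d) :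
    Measure ((∀ i : {i // i ∉ S}, p.Msg i) × p.Aux S) :=
  p.rand.map fun θ => p.view S (x, θ)

/-- The data of the users outside `S`. -/
abbrev surv (S : Finset (Fin n)) (x : Fin n → Fin d) : {i // i ∉ S} → Fin d := fun i => x i

variable {p}

theorem secureGivenSum_of_viewLaw (h : ∀ S, ∀ x x' : Fin n → Fin d,
    histogram (surv S x) = histogram (surv S x') → p.viewLaw S x = p.viewLaw S x') :
    p.SecureGivenSum := fun P _ S =>
  condMutualInfo_prod_eq_zero P p.rand (p.measurable_view S) (g := surv S)
    (measurable_of_countable _) (fun x => histogram (surv S x)) (h S)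

theorem secureBeyond_of_viewLaw {D : ℕ} (h : ∀ S : Finset (Fin n), D < S.card →
    ∀ x x' : Fin n → Fin d, p.viewLaw S x = p.viewLaw S x') : p.SecureBeyond D := by
  intro P hP S hS
  obtain ⟨x₀⟩ : Nonempty (Fin n → Fin d) := nonempty_of_isProbabilityMeasure P
  exact mutualInfo_prod_eq_zero P p.rand (p.measurable_view S) (p.viewLaw S x₀)
    (.of_forall fun x => h S hS x x₀) (g := surv S) (measurable_of_countable _)

end AggProtocol

/-! ### Sufficiency: the one-time-pad protocol. -/

theorem shannonEntropy_le_logb_card {α : Type*} [Finite α] [MeasurableSpace α]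
    [MeasurableSingletonClass α] (P : Measure α) [IsProbabilityMeasure P] :
    shannonEntropy P ≤ ENNReal.ofReal (Real.logb 2 (Nat.card α)) := by
  have := Fintype.ofFinite α
  have : Nonempty α := nonempty_of_isProbabilityMeasure P
  have hN : (0 : ℝ) < Nat.card α := by exact_mod_cast Nat.card_pos
  have hsum : ∑ a, P.real {a} = 1 := by
    rw [sum_measureReal_singleton, Finset.coe_univ, probReal_univ]
  have hlog : (0 : ℝ) < Real.log 2 := Real.log_pos one_lt_two
  rw [shannonEntropy, tsum_fintype, ← ENNReal.ofReal_sum_of_nonneg, ← Finset.sum_div, Real.logb]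
  · gcongr
    -- This is `-t log t ≤ 1 - t` at `t = N p`, divided by `N`; summed over `a`, the first two terms
    -- cancel.
    have hle : ∀ a, Real.negMulLog (P.real {a})
        ≤ (Nat.card α : ℝ)⁻¹ - P.real {a} + P.real {a} * Real.log (Nat.card α) := by
      intro a
      have h := Real.negMulLog_le_one_sub_self
        (mul_nonneg hN.le (measureReal_nonneg (μ := P) (s := {a})))
      rw [Real.negMulLog_mul, Real.negMulLog_def] at h
      rw [Real.negMulLog_def]
      refine le_of_mul_le_mul_left ?_ hN
      rw [mul_add, mul_sub, mul_inv_cancel₀ hN.ne']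
      simp only at h ⊢
      linarith
    refine (Finset.sum_le_sum fun a _ => hle a).trans_eq ?_
    rw [Finset.sum_add_distrib, Finset.sum_sub_distrib, ← Finset.sum_mul, hsum]
    simp [← Nat.card_eq_fintype_card, mul_inv_cancel₀ hN.ne']
  · intro a _
    exact div_nonneg (Real.negMulLog_nonneg measureReal_nonneg measureReal_le_one) hlog.le

theorem map_mul_right_uniformOn {H : Type*} [Group H] [Finite H] [MeasurableSpace H]
    [MeasurableSingletonClass H] (K : Subgroup H) {c : H} (hc : c ∈ K) :
    (uniformOn (K : Set H)).map (fun θ => θ * c) = uniformOn (K : Set H) := by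
  ext s hs
  rw [Measure.map_apply (measurable_of_countable _) hs, uniformOn,
    cond_apply (Set.toFinite _).measurableSet, cond_apply (Set.toFinite _).measurableSet,
    ← Measure.count_injective_image (mul_left_injective c) ((K : Set H) ∩ _)]
  congr 2
  ext θ
  simp only [Set.mem_image, Set.mem_inter_iff, SetLike.mem_coe, Set.mem_preimage]
  constructor
  · rintro ⟨y, ⟨h1, h2⟩, rfl⟩
    exact ⟨mul_mem h1 hc, h2⟩
  · rintro ⟨h1, h2⟩
    exact ⟨θ * c⁻¹, ⟨mul_mem h1 (inv_mem hc), by simpa using h2⟩, by simp⟩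

/-- The tuples in a commutative group whose product is `1`. -/
def prodOneSubgroup (n : ℕ) (G : Type*) [CommGroup G] : Subgroup (Fin n → G) where
  carrier := {θ | ∏ i, θ i = 1}
  one_mem' := by simp
  mul_mem' {a b} ha hb := by
    simp only [Set.mem_ofPred_eq] at ha hb ⊢
    simp [Finset.prod_mul_distrib, ha, hb]
  inv_mem' {a} ha := by
    simp only [Set.mem_ofPred_eq] at ha ⊢
    simp [ha]

theorem mem_prodOneSubgroup {n : ℕ} {G : Type*} [CommGroup G] {θ : Fin n → G} :
    θ ∈ prodOneSubgroup n G ↔ ∏ i, θ i = 1 := Iff.rfl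

/-- The second-round information of `padProtocol`. -/
def padAux {n : ℕ} (D : ℕ) {G : Type*} [CommGroup G] (S : Finset (Fin n)) (θ : Fin n → G) : G :=
  if S = ∅ ∨ D < S.card then 1 else ∏ i : {i // i ∉ S}, θ i

/-- The decoder of `padProtocol`. -/
noncomputable def padDecode {n d : ℕ} {G : Type*} [CommGroup G] (φ : Fin d → G)
    (S : Finset (Fin n)) (v : ({i // i ∉ S} → G) × G) : Fin d → ℕ :=
  -- The default `0` is taken only off the range of the products, where a correct run never lands.
  Function.extend (fun x : {i // i ∉ S} → Fin d => ∏ i, φ (x i)) histogram 0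
    ((∏ i, v.1 i) / v.2)

theorem prod_ite_notMem {n : ℕ} {G : Type*} [CommGroup G] (S : Finset (Fin n)) (r : Fin n → G) :
    ∏ i, (if i ∈ S then 1 else r i) = ∏ i : {i // i ∉ S}, r i := by
  rw [← Finset.prod_subtype (Sᶜ) (p := fun i => i ∉ S) (by simp) r, Finset.prod_ite]
  simp [Finset.filter_not, Finset.compl_eq_univ_sdiff]

/-- One-time pads in a finite abelian group `G` whose product is `1`: user `i` sends
`φ xᵢ * θᵢ`. If at least one and at most `D` users drop out, the server is told the product of
the pads of the others. -/
noncomputable def padProtocol (n : ℕ) {d : ℕ} (D : ℕ) {G : Type} [CommGroup G] [Finite G]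
    [MeasurableSpace G] [MeasurableSingletonClass G] (φ : Fin d → G) : AggProtocol n d where
  Rand _ := G
  rand := uniformOn (prodOneSubgroup n G : Set (Fin n → G))
  randProb := isProbabilityMeasure_uniformOn (Set.toFinite _) ⟨1, one_mem _⟩
  Msg _ := G
  enc _ x θ := φ x * θ
  measurable_enc _ _ := measurable_of_countable _
  Aux _ := G
  aux := padAux D
  measurable_aux _ := measurable_of_countable _
  aux_empty _ _ := by simp [padAux]
  dec := padDecode φ
  measurable_dec _ := measurable_of_countable _

namespace padProtocol

variable {n d D : ℕ} {G : Type} [CommGroup G] [Finite G] [MeasurableSpace G]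
  [MeasurableSingletonClass G] {φ : Fin d → G}

/-- Change of variables: data `x` with pads `θ` look like data `x'` with pads `θ * c`, and this
translation preserves the uniform law on pads with product `1`. -/
theorem viewLaw_eq {S : Finset (Fin n)} {x x' : Fin n → Fin d} (c : Fin n → G)
    (hc : ∏ i, c i = 1) (hcx : ∀ i ∉ S, φ (x i) = φ (x' i) * c i)
    (haux : ∀ θ, padAux D S (θ * c) = padAux D S θ) :
    (padProtocol n D φ).viewLaw S x = (padProtocol n D φ).viewLaw S x' := by
  have hmap : (padProtocol n D φ).rand.map (fun θ : Fin n → G => θ * c) =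
      (padProtocol n D φ).rand :=
    map_mul_right_uniformOn (prodOneSubgroup n G) (mem_prodOneSubgroup.2 hc)
  have hmeas : Measurable fun θ => (padProtocol n D φ).view S (x', θ) :=
    ((padProtocol n D φ).measurable_view S).comp measurable_prodMk_left
  have hmul : Measurable fun θ : Fin n → G => θ * c := measurable_of_countable _
  rw [AggProtocol.viewLaw, AggProtocol.viewLaw]
  conv_rhs => rw [← hmap]
  refine Eq.trans ?_ (Measure.map_map hmeas hmul).symm
  congr 1
  funext (θ : Fin n → G)
  refine Prod.ext (funext fun i => ?_) (haux θ).symm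
  change φ (x i) * θ i = φ (x' i) * (θ i * c i)
  rw [hcx i i.2]
  ac_rfl

theorem secureGivenSum : (padProtocol n D φ).SecureGivenSum := by
  refine AggProtocol.secureGivenSum_of_viewLaw fun S x x' h => ?_
  have hprod : ∏ i : {i // i ∉ S}, φ (x i) / φ (x' i) = 1 := by
    rw [Finset.prod_div_distrib, div_eq_one]
    exact prod_comp_eq_of_histogram_eq h φ
  refine viewLaw_eq (fun i => if i ∈ S then 1 else φ (x i) / φ (x' i)) ?_ ?_ ?_
  · rw [prod_ite_notMem S fun i => φ (x i) / φ (x' i), hprod]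
  · intro i hi
    simp [hi]
  · intro θ
    have : ∏ i : {i // i ∉ S}, (if (i : Fin n) ∈ S then 1 else φ (x i) / φ (x' i)) = 1 :=
      (Finset.prod_congr rfl fun i _ => if_neg i.2).trans hprod
    simp only [padAux, Pi.mul_apply]
    rw [Finset.prod_mul_distrib, this, mul_one]

theorem secureBeyond : (padProtocol n D φ).SecureBeyond D := by
  refine AggProtocol.secureBeyond_of_viewLaw fun S hS x x' => ?_
  obtain ⟨s, hs⟩ : S.Nonempty := Finset.card_pos.1 (by omega)
  -- The unseen message of a dropped user `s` absorbs the correction that makes the product of the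
  -- shift `1`.
  set c : Fin n → G := fun i => φ (x i) / φ (x' i)
  refine viewLaw_eq (c * Pi.mulSingle s (∏ i, c i)⁻¹) ?_ ?_ ?_
  · simp [Finset.prod_mul_distrib, Finset.prod_pi_mulSingle']
  · intro i hi
    have : i ≠ s := fun h => hi (h ▸ hs)
    simp [c, this]
  · intro θ
    simp [padAux, hS]

theorem correct (hφ : ∀ S : Finset (Fin n), ∀ x x' : {i // i ∉ S} → Fin d,
    ∏ i, φ (x i) = ∏ i, φ (x' i) → histogram x = histogram x') :
    (padProtocol n D φ).Correct D := by
  have hdec : ∀ (S : Finset (Fin n)) (x : Fin n → Fin d) (θ : Fin n → G), S.card ≤ D →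
      θ ∈ prodOneSubgroup n G →
      padDecode φ S (fun i => φ (x i) * θ i, padAux D S θ) = histogram (AggProtocol.surv S x) := by
    intro S x θ hS hθ
    have hv : (∏ i : {i // i ∉ S}, φ (x i) * θ i) / padAux D S θ
        = ∏ i : {i // i ∉ S}, φ (x i) := by
      rw [Finset.prod_mul_distrib, padAux]
      split_ifs with h0
      · have hS0 : S = ∅ := h0.resolve_right (by omega)
        rw [← prod_ite_notMem S θ]
        simp [hS0, mem_prodOneSubgroup.1 hθ]
      · rw [mul_div_cancel_right]
    rw [padDecode, hv]
    exact Function.FactorsThrough.extend_apply (fun x x' h => hφ S x x' h) _ (AggProtocol.surv S x)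
  intro P hP S hS
  have hrand : ∀ᵐ θ ∂(padProtocol n D φ).rand, θ ∈ prodOneSubgroup n G :=
    ae_cond_mem (Set.toFinite _).measurableSet
  filter_upwards [Measure.quasiMeasurePreserving_snd.ae hrand] with ω hω
  exact hdec S ω.1 ω.2 hS hω

theorem commCost_le (i : Fin n) :
    (padProtocol n D φ).commCost i ≤ ENNReal.ofReal (Real.logb 2 (Nat.card G)) := by
  refine iSup₂_le fun P hP => ?_
  have : IsProbabilityMeasure ((padProtocol n D φ).law P) := by
    unfold AggProtocol.law; infer_instance
  have := Measure.isProbabilityMeasure_map (μ := (padProtocol n D φ).law P)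
    ((padProtocol n D φ).measurable_msg i).aemeasurable
  have : Finite ((padProtocol n D φ).Msg i) := inferInstanceAs (Finite G)
  exact shannonEntropy_le_logb_card (Measure.map ((padProtocol n D φ).msg i) _)

end padProtocol

theorem exists_aggProtocol_commCost_le (n d D : ℕ) (hn : 1 ≤ n) (hd : 1 ≤ d) :
    ∃ p : AggProtocol n d, p.SecureGivenSum ∧ p.SecureBeyond D ∧ p.Correct D ∧
      ∀ i : Fin n, p.commCost i ≤ ENNReal.ofReal (4 * (n * Real.logb 2 d)) := by
  obtain ⟨G, _, _, φ, hcard, hφ⟩ := exists_commGroup_histogram_eq_of_prod_eq n d hn hd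
  let _ : MeasurableSpace G := ⊤
  refine ⟨padProtocol n D φ, padProtocol.secureGivenSum, padProtocol.secureBeyond,
    padProtocol.correct hφ, fun i => (padProtocol.commCost_le i).trans ?_⟩
  refine ENNReal.ofReal_le_ofReal ?_
  calc Real.logb 2 (Nat.card G) ≤ Real.logb 2 ((d : ℝ) ^ (4 * n)) :=
        Real.logb_le_logb_of_le one_lt_two (by exact_mod_cast Nat.card_pos) (by exact_mod_cast hcard)
    _ = 4 * (n * Real.logb 2 d) := by rw [Real.logb_pow]; push_cast; ring

/-! ### Necessity: the entropy lower bound. -/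

theorem eq_of_forall_update_eq {ι α β : Type*} [Fintype ι] [DecidableEq ι] {F : (ι → α) → β}
    (h : ∀ x i a, F (Function.update x i a) = F x) (x x' : ι → α) : F x = F x' := by
  have : ∀ s : Finset ι, F (s.piecewise x x') = F x' := by
    intro s
    induction s using Finset.induction_on with
    | empty => simp
    | insert i s _ ih => rw [Finset.piecewise_insert, h, ih]
  simpa using this Finset.univ

/-- A function of a tuple that depends neither on the order of the entries nor on the `i`-th
entry, when these invariances hold separately, is constant. -/
theorem eq_of_forall_swap_of_forall_update {ι α β : Type*} [Fintype ι] [DecidableEq ι]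
    {F : (ι → α) → β} (i : ι) (hswap : ∀ x j, F (x ∘ Equiv.swap i j) = F x)
    (hupdate : ∀ x a, F (Function.update x i a) = F x) (x x' : ι → α) : F x = F x' := by
  refine eq_of_forall_update_eq (fun x j a => ?_) x x'
  -- Write `a` at `i`, move it to `j` by the swap, then restore entry `i`.
  have : Function.update x j a
      = Function.update (Function.update x i a ∘ Equiv.swap i j) i (Function.update x j a i) := by
    funext k
    by_cases hki : k = i
    · subst hki; simp
    by_cases hkj : k = j
    · subst hkj; simp [hki]
    · simp [hki, hkj, Equiv.swap_apply_of_ne_of_ne hki hkj]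
  rw [this, hupdate, hswap, hupdate]

/-- Entropy dominates min-entropy: an atom of mass `p` contributes at least `p * L`. -/
theorem ofReal_le_shannonEntropy {α : Type*} [Countable α] [MeasurableSpace α]
    [MeasurableSingletonClass α] (P : Measure α) [IsProbabilityMeasure P] {L : ℝ} (hL : 0 ≤ L)
    (h : ∀ a, P.real {a} ≤ (2 : ℝ) ^ (-L)) : ENNReal.ofReal L ≤ shannonEntropy P := by
  have hlog : (0 : ℝ) < Real.log 2 := Real.log_pos one_lt_two
  have hsum : ∑' a, P {a} = 1 := by
    have := tsum_measure_preimage_singleton (μ := P) (f := id) Set.countable_univ (by simp)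
    simpa [tsum_univ (fun a => P {a})] using this
  rw [← mul_one (ENNReal.ofReal L), ← hsum, ← ENNReal.tsum_mul_left, shannonEntropy]
  refine ENNReal.tsum_le_tsum fun a => ?_
  rw [← ofReal_measureReal (measure_ne_top P {a}), ← ENNReal.ofReal_mul hL]
  refine ENNReal.ofReal_le_ofReal ?_
  rw [le_div_iff₀ hlog, Real.negMulLog_def]
  rcases (measureReal_nonneg (μ := P) (s := {a})).eq_or_lt with h0 | h0
  · simp [← h0]
  have h1 := Real.log_le_log h0 (h a)
  rw [Real.log_rpow two_pos] at h1
  simp only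
  nlinarith [mul_le_mul_of_nonneg_left h1 h0.le]

theorem uniformOn_univ_histogram_preimage_le (n d : ℕ) (h : Fin d → ℕ) :
    uniformOn (Set.univ : Set (Fin n → Fin d)) (histogram ⁻¹' {h})
      ≤ (n : ℝ≥0∞) ^ n / (d : ℝ≥0∞) ^ n := by
  rw [uniformOn_univ, show histogram ⁻¹' {h}
    = ((Finset.univ.filter fun x : Fin n → Fin d => histogram x = h : Finset _) : Set _) by
      ext; simp, Measure.count_apply_finset]
  gcongr
  · exact_mod_cast card_histogram_eq_le n d h
  · simp

namespace AggProtocol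

variable {n d : ℕ} {p : AggProtocol n d}

/-- The messages of all users but `i`. -/
def otherMsgs (p : AggProtocol n d) (i : Fin n) (ω : p.Outcome) : ∀ j : {j // j ≠ i}, p.Msg j :=
  fun j => p.msg j ω

theorem measurable_otherMsgs (i : Fin n) : Measurable (p.otherMsgs i) :=
  measurable_pi_lambda _ fun j => p.measurable_msg j

theorem histogram_surv_empty (x : Fin n → Fin d) : histogram (surv ∅ x) = histogram x :=
  histogram_comp_equiv x (Equiv.subtypeUnivEquiv fun i => Finset.notMem_empty i)

theorem viewLaw_empty_eq (hp : p.SecureGivenSum) {x x' : Fin n → Fin d}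
    (h : histogram x = histogram x') : p.viewLaw ∅ x = p.viewLaw ∅ x' := by
  -- Uniform data charge every tuple, so security speaks about each `x` and `x'`.
  have : IsProbabilityMeasure (uniformOn (Set.univ : Set (Fin n → Fin d))) :=
    isProbabilityMeasure_uniformOn Set.finite_univ ⟨x, trivial⟩
  refine map_eq_of_condMutualInfo_eq_zero (uniformOn Set.univ) p.rand (g := surv ∅) ?_
    (p.measurable_view ∅) (measurable_of_countable _) ?_ (fun x => histogram (surv ∅ x))
    (hp _ this ∅) ?_
  · intro y h0
    rw [uniformOn_eq_zero_iff Set.finite_univ] at h0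
    simp at h0
  · intro y y' hy
    funext i
    exact congrFun hy ⟨i, Finset.notMem_empty i⟩
  · simpa [histogram_surv_empty] using h

/-- Swapping entries `i` and `j` preserves the histogram, hence the law of the view; changing `x i`
leaves the other messages untouched. Combining both removes all dependence on the data. -/
theorem otherMsgs_law_eq (hp : p.SecureGivenSum) (i : Fin n) (x x' : Fin n → Fin d) :
    p.rand.map (fun θ => p.otherMsgs i (x, θ)) = p.rand.map (fun θ => p.otherMsgs i (x', θ)) := by
  have hview : ∀ x, p.rand.map (fun θ => p.otherMsgs i (x, θ))
      = (p.viewLaw ∅ x).map fun v (j : {j // j ≠ i}) => v.1 ⟨j, Finset.notMem_empty _⟩ := by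
    intro x
    have hres : Measurable fun (v : (∀ j : {j // j ∉ (∅ : Finset (Fin n))}, p.Msg j) × p.Aux ∅)
        (j : {j // j ≠ i}) => v.1 ⟨j, Finset.notMem_empty _⟩ := by fun_prop
    have hmeas : Measurable fun θ => p.view ∅ (x, θ) :=
      (p.measurable_view ∅).comp measurable_prodMk_left
    exact (Measure.map_map hres hmeas).symm
  refine eq_of_forall_swap_of_forall_update
    (F := fun x => p.rand.map (fun θ => p.otherMsgs i (x, θ))) i (fun x j => ?_) (fun x a => ?_) x x'
  · simp only [hview]
    rw [viewLaw_empty_eq hp (histogram_comp_equiv x (Equiv.swap i j))]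
  · congr 1
    funext θ j
    simp [otherMsgs, msg, j.2]

/-- All messages together, from the message of user `i` and the other ones. -/
def joinMsgs {p : AggProtocol n d} (i : Fin n) (y : p.Msg i) (w : ∀ j : {j // j ≠ i}, p.Msg j)
    (j : {j // j ∉ (∅ : Finset (Fin n))}) : p.Msg j :=
  if h : i = j then h ▸ y else w ⟨j, Ne.symm h⟩

theorem joinMsgs_msg_otherMsgs (i : Fin n) (ω : p.Outcome) :
    joinMsgs i (p.msg i ω) (p.otherMsgs i ω) =
      fun j : {j // j ∉ (∅ : Finset (Fin n))} => p.msg j ω := by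
  funext ⟨j, hj⟩
  by_cases h : i = j
  · subst h; simp [joinMsgs]
  · simp [joinMsgs, h, otherMsgs]

/-- On `Yᵢ = y` the histogram equals `f w`, with `w` the other messages. As `w` is independent of
the uniform data, each `w` contributes at most `ν {w} * (n/d)^n`. -/
theorem measure_msg_preimage_le {D : ℕ} (hp : p.SecureGivenSum) (hc : p.Correct D) (i : Fin n)
    (hd : 1 ≤ d) (y : p.Msg i) :
    p.law (uniformOn Set.univ) (p.msg i ⁻¹' {y}) ≤ (n : ℝ≥0∞) ^ n / (d : ℝ≥0∞) ^ n := by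
  have hP : IsProbabilityMeasure (uniformOn (Set.univ : Set (Fin n → Fin d))) :=
    isProbabilityMeasure_uniformOn Set.finite_univ ⟨fun _ => ⟨0, hd⟩, trivial⟩
  obtain ⟨θ₀⟩ : Nonempty (∀ i, p.Rand i) := nonempty_of_isProbabilityMeasure p.rand
  let ν := p.rand.map fun θ => p.otherMsgs i (fun _ => ⟨0, hd⟩, θ)
  have hν : IsProbabilityMeasure ν := Measure.isProbabilityMeasure_map
    ((measurable_otherMsgs i).comp measurable_prodMk_left).aemeasurable
  -- Any `θ₀` will do, since the second round is constant without dropouts.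
  let f (w : ∀ j : {j // j ≠ i}, p.Msg j) : Fin d → ℕ := p.dec ∅ (joinMsgs i y w, p.aux ∅ θ₀)
  have hsum : ∑' w, ν {w} = 1 := by
    have := tsum_measure_preimage_singleton (μ := ν) (f := id) Set.countable_univ (by simp)
    simpa [tsum_univ (fun a => ν {a})] using this
  calc p.law (uniformOn Set.univ) (p.msg i ⁻¹' {y})
      ≤ p.law (uniformOn Set.univ)
          (⋃ w, p.otherMsgs i ⁻¹' {w} ∩ Prod.fst ⁻¹' (histogram ⁻¹' {f w})) := by
        refine measure_mono_ae ?_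
        filter_upwards [hc _ hP ∅ (by simp)] with ω hω hy
        refine Set.mem_iUnion.2 ⟨p.otherMsgs i ω, rfl, ?_⟩
        obtain rfl : p.msg i ω = y := hy
        change histogram ω.1 = p.dec ∅ _
        rw [joinMsgs_msg_otherMsgs, ← histogram_surv_empty, p.aux_empty θ₀ ω.2]
        exact hω.symm
    _ ≤ ∑' w, p.law (uniformOn Set.univ)
          (p.otherMsgs i ⁻¹' {w} ∩ Prod.fst ⁻¹' (histogram ⁻¹' {f w})) := measure_iUnion_le _
    _ ≤ ∑' w, ν {w} * ((n : ℝ≥0∞) ^ n / (d : ℝ≥0∞) ^ n) := by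
        refine ENNReal.tsum_le_tsum fun w => ?_
        rw [law, prod_inter_fst_preimage _ _ (measurable_otherMsgs i) ν
          (.of_forall fun x => otherMsgs_law_eq hp i x _) (measurableSet_singleton w)
          (Set.toFinite _).measurableSet]
        gcongr
        exact uniformOn_univ_histogram_preimage_le n d _
    _ = _ := by rw [ENNReal.tsum_mul_right, hsum, one_mul]

theorem le_commCost {D : ℕ} {κ : ℝ} (hκ : 0 < κ) (hd : 1 ≤ d) (hnd : (n : ℝ) ≤ (d : ℝ) ^ (1 - κ))
    (hp : p.SecureGivenSum) (hc : p.Correct D) (i : Fin n) :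
    ENNReal.ofReal (κ * (n * Real.logb 2 d)) ≤ p.commCost i := by
  have hP : IsProbabilityMeasure (uniformOn (Set.univ : Set (Fin n → Fin d))) :=
    isProbabilityMeasure_uniformOn Set.finite_univ ⟨fun _ => ⟨0, hd⟩, trivial⟩
  have : IsProbabilityMeasure (p.law (uniformOn Set.univ)) := by
    unfold law; infer_instance
  have := Measure.isProbabilityMeasure_map (μ := p.law (uniformOn Set.univ))
    (p.measurable_msg i).aemeasurable
  have hd0 : (0 : ℝ) < d := by exact_mod_cast hd
  have hlogd : 0 ≤ Real.logb 2 d := Real.logb_nonneg one_lt_two (by exact_mod_cast hd)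
  refine le_trans ?_ (le_iSup₂ (f := fun (P : Measure (Fin n → Fin d))
    (_ : IsProbabilityMeasure P) => shannonEntropy ((p.law P).map (p.msg i))) _ hP)
  refine ofReal_le_shannonEntropy _ (by positivity) fun y => ?_
  rw [measureReal_def, Measure.map_apply (p.measurable_msg i) (measurableSet_singleton y)]
  have h1 := ENNReal.toReal_mono (ENNReal.div_ne_top (by finiteness) (by positivity))
    (measure_msg_preimage_le hp hc i hd y)
  refine h1.trans ?_
  -- Both sides become `n`-th powers, reducing the claim to `n / d ≤ d^(-κ)`.
  rw [ENNReal.toReal_div, ENNReal.toReal_pow, ENNReal.toReal_pow, ENNReal.toReal_natCast,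
    ENNReal.toReal_natCast, ← div_pow,
    show -(κ * (n * Real.logb 2 d)) = Real.logb 2 d * (-κ) * n by ring,
    Real.rpow_mul two_pos.le, Real.rpow_mul two_pos.le,
    Real.rpow_logb two_pos (by norm_num) hd0, Real.rpow_natCast]
  gcongr
  rw [div_le_iff₀ hd0]
  calc (n : ℝ) ≤ (d : ℝ) ^ (1 - κ) := hnd
    _ = (d : ℝ) ^ (-κ) * d := by
      rw [show 1 - κ = -κ + 1 by ring, Real.rpow_add_one hd0.ne']

end AggProtocol

theorem mainTheorem1 :
    (∀ κ : ℝ, 0 < κ → κ < 1 → ∃ c : ℝ, 0 < c ∧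
      ∀ n d D : ℕ, 1 ≤ n → (n : ℝ) ≤ (d : ℝ) ^ (1 - κ) →
        ∀ p : AggProtocol n d, p.SecureGivenSum → p.SecureBeyond D → p.Correct D →
          ∀ i : Fin n, ENNReal.ofReal (c * (n * Real.logb 2 d)) ≤ p.commCost i) ∧
    (∃ C : ℝ, 0 < C ∧
      ∀ n d D : ℕ, 1 ≤ n → 1 ≤ d →
        ∃ p : AggProtocol n d, p.SecureGivenSum ∧ p.SecureBeyond D ∧ p.Correct D ∧
          ∀ i : Fin n, p.commCost i ≤ ENNReal.ofReal (C * (n * Real.logb 2 d))) := by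
  refine ⟨fun κ hκ hκ1 => ⟨κ, hκ, fun n d D hn hnd p hp _ hc i => ?_⟩,
    4, by norm_num, exists_aggProtocol_commCost_le⟩
  refine AggProtocol.le_commCost hκ (Nat.one_le_iff_ne_zero.2 ?_) hnd hp hc i
  -- `d = 0` is impossible: as `κ < 1`, `0^(1-κ) = 0 < n`.
  rintro rfl
  rw [Nat.cast_zero, Real.zero_rpow (by linarith)] at hnd
  have : (1 : ℝ) ≤ n := by exact_mod_cast hn
  linarith
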